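/- **Theorem (Stability of multiplicities in fusion rules).** Let $G$ be a simple Lie group with complexified Lie algebra $\mathfrak g_{\mathbb C}=\mathfrak{sl}(2,\mathbb C)$ such that the inclusion $\mathfrak g\subset\mathfrak{sl}(2,\mathbb C)$ is the differential of a Lie group homomorphism $G\to SL(2,\mathbb C)$ with finite kernel (for example a real form of $SL(2,\mathbb C)$, or a finite cover of one); thus $G$ acts on $\mathbb C^2$. Let $\mathcal M(G)$ be the category of admissible smooth Fréchet representations of $G$ of finite length and moderate growth. Let $\Omega=H^2+2(XY+YX)$ be the Casimir element, which generates the center of $U(\mathfrak g_{\mathbb C})$. A representation has infinitesimal character $\lambda\in\mathbb C/\{\pm1\}$ if $\Omega$ acts on it by $\lambda^2-1$, and $P_\lambda$ denotes the projection to the generalized eigenspace of $\Omega$ for the eigenvalue $\lambda^2-1$. For $\xi\in\mathbb C\setminus\{0\}$ set $\Lambda(\xi)=\mathbb Z+\xi$ if $\xi\notin\mathbb Z$, $\Lambda(\xi)=\{1,2,\dots\}$ if $\xi\in\{1,2,\dots\}$, and $\Lambda(\xi)=\{-1,-2,\dots\}$ if $\xi\in\{-1,-2,\dots\}$. A reduced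 coherent family through $\Pi_\xi$ is a family $\{\Pi_\lambda\in\mathcal M(G):\lambda\in\Lambda(\xi)\}$ such that $\Pi_\lambda$ has infinitesimal character $\lambda$ and, for $\delta=\pm1$ and $\lambda,\lambda+\delta\in\Lambda(\xi)$, $$P_{\lambda+\delta}(\Pi_\lambda\otimes\mathbb C^2)\simeq\Pi_{\lambda+\delta},\qquad P_{\lambda}(\Pi_{\lambda+\delta}\otimes\mathbb C^2)\simeq\Pi_{\lambda}.$$ For $\xi',\xi''\in\mathbb C\setminus\{0\}$ set $$\Xi=\{(\xi'+k_1,\xi''+k_2)\in\Lambda(\xi')\times\Lambda(\xi''): k_1,k_2\in\mathbb Z,\ k_1\equiv k_2 \bmod 2\}.$$ For $\mu\in\mathbb C$ and $\alpha,\beta\in\{1,-1\}$ let $\mathcal D_{\alpha\beta}=\Xi$ if $\alpha\xi'+\beta\xi''+\mu\notin 2\mathbb Z+1$, and $$\mathcal D_{\alpha\beta}=\{(\lambda',\lambda'')\in\Xi:\operatorname{sgn}(\alpha\lambda'+\beta\lambda''+\mu)=\operatorname{sgn}(\alpha\xi'+\beta\xi''+\mu)\}$$ if $\alpha\xi'+\beta\xi''+\mu\in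 2\mathbb Z+1$. Let $\mathcal D(\xi',\xi'';\mu)=\bigcap_{\alpha,\beta\in\{1,-1\}}\mathcal D_{\alpha\beta}$. Let $\{\Pi'_{\lambda'}:\lambda'\in\Lambda(\xi')\}$ and $\{\Pi''_{\lambda''}:\lambda''\in\Lambda(\xi'')\}$ be reduced coherent families in $\mathcal M(G)$, where $\xi',\xi''\neq0$, and let $\Pi_{\lambda'''}\in\mathcal M(G)$ have infinitesimal character $\lambda'''\in\mathbb C$. Then the multiplicity $$[\Pi'_{\lambda'}\boxtimes\Pi''_{\lambda''}:\Pi_{\lambda'''}]=\dim\operatorname{Hom}_G(\Pi'_{\lambda'}\boxtimes\Pi''_{\lambda''},\Pi_{\lambda'''})$$ (the dimension of the space of continuous homomorphisms equivariant for the diagonal action of $G$) takes the same value at all $(\lambda',\lambda'')\in\mathcal D(\xi',\xi'';\lambda''')$. In particular, it may change only when crossing the boundary: if $p\in\mathcal D(\xi',\xi'';\lambda''')$ and $q\in\Xi$ give different multiplicities, then there are $\alpha,\beta\in\{1,-1\}$ with $\alpha\xi'+\beta\xi''+\lambda'''\in2\mathbb Z+1$ such that $\alpha\lambda'+\beta\lambda''+\lambda'''$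 has different signs at $(\lambda',\lambda'')=p$ and at $(\lambda',\lambda'')=q$. -/

import Mathlib

open scoped Manifold ContDiff TensorProduct Topology Matrix

noncomputable section

namespace SL2Fusion

universe u v

/-- The complex Lie algebra `𝔰𝔩(2, ℂ)`. -/
abbrev sl2 : Type := LieAlgebra.SpecialLinear.sl (Fin 2) ℂ

/-- The standard basis `H, X, Y` of `𝔰𝔩(2, ℂ)`. -/
def H : sl2 := ⟨!![1, 0; 0, -1], by simp [LieAlgebra.SpecialLinear.sl, Matrix.trace_fin_two]⟩

/-- See `H`. -/
def X : sl2 := ⟨!![0, 1; 0, 0], by simp [LieAlgebra.SpecialLinear.sl, Matrix.trace_fin_two]⟩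

/-- See `H`. -/
def Y : sl2 := ⟨!![0, 0; 1, 0], by simp [LieAlgebra.SpecialLinear.sl, Matrix.trace_fin_two]⟩

/-! ### The group -/

section Group

variable (G : Type v) [Group G] [TopologicalSpace G] [ChartedSpace (EuclideanSpace ℝ (Fin 3)) G]

/-- A smooth real Lie group is `C³`, which is what Mathlib's Lie algebra of a Lie group asks for. -/
instance instLieGroupMinSmoothness [LieGroup (𝓡 3) ∞ G] :
    LieGroup (𝓡 3) (minSmoothness ℝ 3) G := by
  rw [minSmoothness_of_isRCLikeNormedField]
  infer_instance

/-- The real Lie algebra `𝔤` of `G`. -/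
abbrev LieAlg : Type := GroupLieAlgebra (𝓡 3) G

/-- A Lie group `G` with `𝔤_ℂ = 𝔰𝔩(2, ℂ)` (hence simple, of real dimension 3) on which the
natural representation `ℂ²` of `𝔤_ℂ` is defined: the inclusion `𝔤 ⊂ 𝔰𝔩(2, ℂ)` is the differential
of a homomorphism `G → SL(2, ℂ)`. The kernel is finite, so that `G` is a finite cover of a
real form of `SL(2, ℂ)`, and thus a real reductive group. -/
structure SL2Group [LieGroup (𝓡 3) ∞ G] where
  /-- the identification `𝔤_ℂ = 𝔰𝔩(2, ℂ)` -/
  Φ : (ℂ ⊗[ℝ] LieAlg G) ≃ₗ⁅ℂ⁆ sl2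
  /-- the natural representation on `ℂ²` -/
  φ : G →* Matrix.SpecialLinearGroup (Fin 2) ℂ
  smooth : ∀ i j, ContMDiff (𝓡 3) 𝓘(ℝ, ℂ) ∞ (fun g : G => (φ g).val i j)
  differential : ∀ (A : LieAlg G) (i j : Fin 2),
    mfderiv (𝓡 3) 𝓘(ℝ, ℂ) (fun g : G => (φ g).val i j) 1 A = (Φ (1 ⊗ₜ[ℝ] A)).val i j
  finite_ker : Finite φ.ker

end Group

/-! ### Representations on Fréchet spaces -/

/-- A continuous representation of the topological group `G` on a complex Fréchet space. -/
structure FrechetRep (G : Type v) [Group G] [TopologicalSpace G] where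
  /-- the underlying Fréchet space -/
  V : Type u
  [addCommGroup : AddCommGroup V]
  [module : Module ℂ V]
  [uniformSpace : UniformSpace V]
  [isUniformAddGroup : IsUniformAddGroup V]
  [continuousSMul : ContinuousSMul ℂ V]
  [locallyConvex : LocallyConvexSpace ℝ V]
  [t2 : T2Space V]
  [firstCountable : FirstCountableTopology V]
  [complete : CompleteSpace V]
  /-- the action of the group -/
  ρ : ContRepresentation ℂ G V
  continuous_action : Continuous fun p : G × V => ρ p.1 p.2

attribute [instance] FrechetRep.addCommGroup FrechetRep.module FrechetRep.uniformSpace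
  FrechetRep.isUniformAddGroup FrechetRep.continuousSMul FrechetRep.locallyConvex FrechetRep.t2
  FrechetRep.firstCountable FrechetRep.complete

section Rep

variable {G : Type v} [Group G] [TopologicalSpace G] [ChartedSpace (EuclideanSpace ℝ (Fin 3)) G]

/-- The left translate to `g` of the preferred chart at `1`, as a parametrization of a
neighbourhood of `g`; the base point `extChartAt (𝓡 3) 1 1` is mapped to `g`. -/
def param (g : G) (x : EuclideanSpace ℝ (Fin 3)) : G :=
  g * (extChartAt (𝓡 3) (1 : G)).symm x

/-- `f : G → V` is of class `Cⁿ`, for a topological vector space `V`: it is continuous and, for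
`n = k + 1`, it is differentiable at each point `g` and its derivatives along the left-invariant
vector fields are of class `Cᵏ`. -/
def IsCn {V : Type u} [AddCommGroup V] [Module ℂ V] [TopologicalSpace V] :
    ℕ → (G → V) → Prop
  | 0, f => Continuous f
  | n + 1, f => Continuous f ∧ ∃ f' : G → EuclideanSpace ℝ (Fin 3) →L[ℝ] V,
      (∀ g, HasFDerivAt (fun x => f (param g x)) (f' g) (extChartAt (𝓡 3) (1 : G) 1)) ∧
      ∀ A, IsCn n (fun g => f' g A)

namespace FrechetRep

variable (P : FrechetRep.{u} G)

/-- A Fréchet representation is smooth if all its orbit maps are `C^∞`. -/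
def IsSmooth : Prop := ∀ (w : P.V) (n : ℕ), IsCn n (fun g : G => P.ρ g w)

/-- `A ↦ dρ(A) w` on `𝔤`: the derivative at the identity of the orbit map of `w`. -/
def dρ (w : P.V) : LieAlg G →ₗ[ℝ] P.V :=
  (fderiv ℝ (fun x => P.ρ (param (1 : G) x) w) (extChartAt (𝓡 3) (1 : G) 1)).toLinearMap

/-- A closed `G`-invariant subspace. -/
def IsClosedInvariant (W : Submodule ℂ P.V) : Prop :=
  IsClosed (W : Set P.V) ∧ ∀ (g : G), ∀ w ∈ W, P.ρ g w ∈ W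

/-- Finite length: a finite chain of closed invariant subspaces with topologically irreducible
successive quotients. -/
def HasFiniteLength : Prop :=
  ∃ (n : ℕ) (F : Fin (n + 1) → Submodule ℂ P.V),
    F 0 = ⊥ ∧ F (Fin.last n) = ⊤ ∧ (∀ i, P.IsClosedInvariant (F i)) ∧
    ∀ i : Fin n, F i.castSucc < F i.succ ∧
      ∀ W, P.IsClosedInvariant W → F i.castSucc ≤ W → W ≤ F i.succ →
        W = F i.castSucc ∨ W = F i.succ

/-- Admissibility: every irreducible finite-dimensional continuous representation of a
maximal compact subgroup occurs with finite multiplicity. -/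
def IsAdmissible : Prop :=
  ∀ K : Subgroup G, Maximal (fun L : Subgroup G => IsCompact (L : Set G)) K →
    ∀ (n : ℕ) (σ : Representation ℂ K (Fin n → ℂ)),
      (∀ w, Continuous fun k : K => σ k w) → σ.IsIrreducible →
      FiniteDimensional ℂ (σ.IntertwiningMap (P.ρ.toRepresentation.comp K.subtype))

variable [LieGroup (𝓡 3) ∞ G] (S : SL2Group G)

/-- The norm on the group `G` (up to equivalence). -/
def groupNorm (g : G) : ℝ :=
  ∑ i, ∑ j, (‖(S.φ g).val i j‖ + ‖(S.φ g⁻¹).val i j‖)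

/-- Moderate growth: for every continuous seminorm `p` there are a continuous seminorm `q` and
`N` with `p (ρ(g) w) ≤ ‖g‖ ^ N q (w)`. -/
def HasModerateGrowth : Prop :=
  ∀ p : Seminorm ℂ P.V, Continuous p → ∃ (q : Seminorm ℂ P.V) (N : ℕ), Continuous q ∧
    ∀ (g : G) (w : P.V), p (P.ρ g w) ≤ groupNorm S g ^ N * q w

/-- The objects of `𝓜(G)`: admissible smooth Fréchet representations of finite length and of
moderate growth. -/
structure IsInM : Prop where
  smooth : P.IsSmooth
  admissible : P.IsAdmissible
  finiteLength : P.HasFiniteLength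
  moderateGrowth : P.HasModerateGrowth S

/-- The action of `𝔤_ℂ = 𝔰𝔩(2, ℂ)`, the complex-linear extension of `dρ`. -/
def act (Z : sl2) (w : P.V) : P.V :=
  (P.dρ w).liftBaseChange ℂ (S.Φ.symm Z)

/-- The action of the Casimir element `Ω = H² + 2 (X Y + Y X)`, which generates the center of
`U(𝔰𝔩(2, ℂ))`. -/
def casimir (w : P.V) : P.V :=
  P.act S H (P.act S H w) +
    (2 : ℂ) • (P.act S X (P.act S Y w) + P.act S Y (P.act S X w))

/-- `P` has infinitesimal character `l ∈ ℂ/{±1}`: the center `ℂ[Ω]` of the enveloping algebra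
acts by the character `Ω ↦ l² - 1`. -/
def HasInfChar (l : ℂ) : Prop := ∀ w : P.V, P.casimir S w = (l ^ 2 - 1) • w

/-- The primary component `P_l` for the infinitesimal character `l`: the generalized eigenspace
of the center `ℂ[Ω]` for the character `Ω ↦ l² - 1`. -/
def primary (l : ℂ) : Set P.V :=
  {w | ∃ k : ℕ, (fun z => P.casimir S z - (l ^ 2 - 1) • z)^[k] w = 0}

/-- The diagonal action of `g` on `P ⊗ ℂ²`, where `w 0 ⊗ f₊ + w 1 ⊗ f₋` is written as
`w : Fin 2 → P.V`. -/
def tensorAct (g : G) : (Fin 2 → P.V) →L[ℂ] (Fin 2 → P.V) :=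
  ContinuousLinearMap.pi fun i =>
    ∑ j, (S.φ g).val i j • (P.ρ g).comp (ContinuousLinearMap.proj j)

@[simp] lemma tensorAct_apply (g : G) (w : Fin 2 → P.V) (i : Fin 2) :
    P.tensorAct S g w i = ∑ j, (S.φ g).val i j • P.ρ g (w j) := by
  simp [tensorAct]

/-- The representation `P ⊗ ℂ²`. -/
def tensorC2 : FrechetRep.{u} G where
  V := Fin 2 → P.V
  locallyConvex := inferInstance
  ρ := .ofMonoidHom
    { toFun := P.tensorAct S
      map_one' := by
        ext w i
        fin_cases i <;> simp
      map_mul' := fun g h => by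
        ext w i
        simp [Fin.sum_univ_two, Matrix.mul_apply, add_smul, mul_smul]
        module }
  continuous_action := by
    have hφ : ∀ i j, Continuous fun g : G => (S.φ g).val i j := fun i j => (S.smooth i j).continuous
    refine continuous_pi fun i => ?_
    change Continuous fun p : G × (Fin 2 → P.V) => P.tensorAct S p.1 p.2 i
    simp only [tensorAct_apply]
    refine continuous_finsetSum _ fun j _ => ?_
    refine ((hφ i j).comp continuous_fst).smul ?_
    exact P.continuous_action.comp
      (continuous_fst.prodMk ((continuous_apply j).comp continuous_snd))

/-- `P_l(P ⊗ ℂ²) ≃ Q`, as topological `G`-modules: `Q` embeds topologically and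
equivariantly into `P ⊗ ℂ²`, with image the primary component. -/
def TranslatesTo (l : ℂ) (Q : FrechetRep.{u} G) : Prop :=
  ∃ j : ContIntertwiningMap Q.ρ (P.tensorC2 S).ρ,
    Topology.IsEmbedding j.toContinuousLinearMap ∧
      Set.range j.toContinuousLinearMap = (P.tensorC2 S).primary S l

end FrechetRep

/-- The parameter set `Λ(ξ)`. -/
def Lam (ξ : ℂ) : Set ℂ :=
  {l | ((∀ n : ℤ, ξ ≠ n) ∧ ∃ n : ℤ, l = n + ξ) ∨
    ((∃ n : ℤ, 0 < n ∧ ξ = n) ∧ ∃ n : ℤ, 0 < n ∧ l = n) ∨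
    ((∃ n : ℤ, n < 0 ∧ ξ = n) ∧ ∃ n : ℤ, n < 0 ∧ l = n)}

/-- `{F l : l ∈ Λ(ξ)}` is a reduced coherent family in `𝓜(G)` (passing through `F ξ`);
the values of `F` outside `Λ(ξ)` play no role. -/
structure IsReducedCoherentFamily [LieGroup (𝓡 3) ∞ G] (S : SL2Group G) (ξ : ℂ)
    (F : ℂ → FrechetRep.{u} G) : Prop where
  mem : ∀ l ∈ Lam ξ, (F l).IsInM S
  infChar : ∀ l ∈ Lam ξ, (F l).HasInfChar S l
  translate : ∀ δ : ℤˣ, ∀ l ∈ Lam ξ, l + ((δ : ℤ) : ℂ) ∈ Lam ξ →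
    (F l).TranslatesTo S (l + ((δ : ℤ) : ℂ)) (F (l + ((δ : ℤ) : ℂ))) ∧
    (F (l + ((δ : ℤ) : ℂ))).TranslatesTo S l (F l)

/-! ### Multiplicities -/

/-- The space `Hom_G(P' ⊠ P'', P''')` of symmetry breaking operators for the diagonal subgroup
`G ⊂ G × G`. By the universal property of the completed projective tensor product, these are
the continuous `G`-equivariant bilinear maps `P' × P'' → P'''`. -/
def homG (P' P'' P''' : FrechetRep.{u} G) : Submodule ℂ (P'.V →ₗ[ℂ] P''.V →ₗ[ℂ] P'''.V) where
  carrier := {T | Continuous (fun p : P'.V × P''.V => T p.1 p.2) ∧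
    ∀ (g : G) (a : P'.V) (b : P''.V), T (P'.ρ g a) (P''.ρ g b) = P'''.ρ g (T a b)}
  add_mem' := fun hS hT => ⟨hS.1.add hT.1, fun g a b => by simp [hS.2, hT.2]⟩
  zero_mem' := ⟨by simpa using continuous_const, fun g a b => by simp⟩
  smul_mem' := fun c T hT => ⟨hT.1.const_smul c, fun g a b => by simp [hT.2]⟩

/-- The multiplicity `[P' ⊠ P'' : P''']`. -/
def mult (P' P'' P''' : FrechetRep.{u} G) : Cardinal.{u} :=
  Module.rank ℂ (homG P' P'' P''')

end Rep

/-! ### Fences -/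

/-- The parameter lattice `Ξ(ξ', ξ'')`. -/
def Xi (ξ' ξ'' : ℂ) : Set (ℂ × ℂ) :=
  {p | p.1 ∈ Lam ξ' ∧ p.2 ∈ Lam ξ'' ∧
    ∃ k₁ k₂ : ℤ, k₁ ≡ k₂ [ZMOD 2] ∧ p = (ξ' + k₁, ξ'' + k₂)}

/-- `α x + β y + μ` for signs `α`, `β`. -/
def lin (α β : ℤˣ) (μ : ℂ) (p : ℂ × ℂ) : ℂ :=
  ((α : ℤ) : ℂ) * p.1 + ((β : ℤ) : ℂ) * p.2 + μ

/-- The parity condition `α ξ' + β ξ'' + μ ∈ 2ℤ + 1`. -/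
def ParityCond (ξ' ξ'' μ : ℂ) (α β : ℤˣ) : Prop :=
  ∃ n : ℤ, lin α β μ (ξ', ξ'') = 2 * n + 1

/-- The set `𝓓_{αβ}(ξ', ξ'', μ)`. If the parity condition holds, then `lin α β μ` takes (odd)
integer values on `Ξ`, so that its sign is the sign of its real part. -/
def Dab (ξ' ξ'' μ : ℂ) (α β : ℤˣ) : Set (ℂ × ℂ) :=
  {p | p ∈ Xi ξ' ξ'' ∧ (ParityCond ξ' ξ'' μ α β →
    SignType.sign (lin α β μ p).re = SignType.sign (lin α β μ (ξ', ξ'')).re)}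

/-- The region `𝓓(ξ', ξ''; μ)`. -/
def D (ξ' ξ'' μ : ℂ) : Set (ℂ × ℂ) := ⋂ α : ℤˣ, ⋂ β : ℤˣ, Dab ξ' ξ'' μ α β

end SL2Fusion

end

noncomputable section

namespace SL2Fusion

universe u v

/-! ### Differentiation in topological vector spaces -/

section TVS

open Filter Asymptotics

variable {E V W : Type*} [NormedAddCommGroup E] [NormedSpace ℝ E]
  [AddCommGroup V] [Module ℂ V] [TopologicalSpace V] [IsTopologicalAddGroup V] [ContinuousSMul ℂ V]
  [AddCommGroup W] [Module ℂ W] [TopologicalSpace W] [IsTopologicalAddGroup W] [ContinuousSMul ℂ W]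

/-! Both parameters are translated at once. Equivariant maps `R' → P' ⊗ ℂ²` and `R'' → P'' ⊗ ℂ²`,
followed by the invariant symplectic form on `ℂ²`, turn an invariant bilinear map `T` on `P' × P''`
into one on `R' × R''` (`contract`). Write the Casimir element on `P ⊗ ℂ²` as `l² + 2 + 2L`. The
primary component for `l + 1` contains the image of `L + 1 + l`. If the contraction of `T` vanishes,
evaluating it on two pairs of such vectors and applying the Casimir element to `T a b` gives `((l' +
l'' + 1)² - μ²) T a b = 0`. Hence translation is injective on multiplicity spaces off the wall
(`mult_le_of_translatesTo`). The reverse translation has the same wall, so multiplicities agree.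
Infinitesimal characters matter only up to sign, so this covers all four diagonal unit steps.

The rest is lattice geometry: a diagonal step inside `D` never meets a wall (`off_wall_of_mem_D`),
and two points of `D` are joined by at most two diagonal segments in `D` (`eq_of_mem_D`).

The algebra needs the commutation relations of `𝔰𝔩(2, ℂ)` for the differentiated Fréchet action.
Second derivatives along left-invariant fields commute up to constants that depend on `G` alone;
matrix coefficients of `φ` identify these constants with brackets in `𝔰𝔩(2, ℂ)`. -/

omit [IsTopologicalAddGroup V] in
theorem continuousSMul_real : ContinuousSMul ℝ V :=
  ⟨by
    have : (fun p : ℝ × V => p.1 • p.2) = fun p : ℝ × V => (p.1 : ℂ) • p.2 := by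
      ext p; exact (Complex.coe_smul p.1 p.2).symm
    rw [this]
    exact (Complex.continuous_ofReal.comp continuous_fst).smul continuous_snd⟩

omit [IsTopologicalAddGroup V] in
-- Only the source is normed, so the remainder can be divided by a norm there, and differentiability
-- becomes a limit in the topology of `V`.
theorem hasFDerivAt_iff_tendsto_inv_norm_smul {f : E → V} {f' : E →L[ℝ] V} {x : E} :
    HasFDerivAt f f' x ↔
      Tendsto (fun y => ‖y - x‖⁻¹ • (f y - f x - f' (y - x))) (𝓝 x) (𝓝 0) := by
  have : ContinuousSMul ℝ V := continuousSMul_real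
  rw [hasFDerivAt_iff_isLittleOTVS, ← isLittleOTVS_iff_tendsto_inv_smul (𝕜 := ℝ)]
  · have : (fun y : E => y - x) =Θ[ℝ; 𝓝 x] fun y => ‖y - x‖ :=
      isThetaTVS_iff_isTheta.2 (isTheta_norm_right.2 (isTheta_refl _ _))
    exact ⟨fun h => h.trans_isThetaTVS this, fun h => h.trans_isThetaTVS this.symm⟩
  · refine Eventually.of_forall fun y hy => ?_
    rw [norm_eq_zero, sub_eq_zero] at hy
    simp [hy]

omit [IsTopologicalAddGroup V] in
-- Balanced neighbourhoods of zero are stable under scalars of norm at most 1; the bound `M` is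
-- first absorbed by rescaling with `|M| + 1`, which is never zero.
theorem tendsto_bounded_smul_zero {α : Type*} {l : Filter α} {c : α → ℂ} {M : ℝ}
    (hc : ∀ a, ‖c a‖ ≤ M) {w : α → V} (hw : Tendsto w l (𝓝 0)) :
    Tendsto (fun a => c a • w a) l (𝓝 0) := by
  have hM : Tendsto (fun a => ((|M| + 1 : ℝ) : ℂ) • w a) l (𝓝 0) := by
    simpa using hw.const_smul ((|M| + 1 : ℝ) : ℂ)
  rw [(nhds_basis_balanced ℂ V).tendsto_right_iff] at hM ⊢
  intro U hU
  filter_upwards [hM U hU] with a ha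
  have hpos : (0 : ℝ) < |M| + 1 := by positivity
  have h0 : ((|M| + 1 : ℝ) : ℂ) ≠ 0 := by exact_mod_cast hpos.ne'
  have : c a • w a = (c a / ((|M| + 1 : ℝ) : ℂ)) • (((|M| + 1 : ℝ) : ℂ) • w a) := by
    rw [smul_smul, div_mul_cancel₀ _ h0]
  rw [this]
  refine hU.2.smul_mem ?_ ha
  rw [norm_div, Complex.norm_real, Real.norm_of_nonneg hpos.le, div_le_one hpos]
  linarith [hc a, le_abs_self M]

/-- The product rule for a scalar function and a function with values in a topological vector
space. -/
theorem hasFDerivAt_smul_tvs {c : E → ℂ} {c' : E →L[ℝ] ℂ} {f : E → V} {f' : E →L[ℝ] V} {x : E}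
    (hc : HasFDerivAt c c' x) (hf : HasFDerivAt f f' x)
    {h : E →L[ℝ] V} (hh : ∀ v, h v = c' v • f x + c x • f' v) :
    HasFDerivAt (fun y => c y • f y) h x := by
  have : ContinuousSMul ℝ V := continuousSMul_real
  have hfc : ContinuousAt f x := hf.continuousAt
  rw [hasFDerivAt_iff_tendsto_inv_norm_smul] at hc hf ⊢
  have h1 := hc.smul hfc.tendsto
  have h2 := hf.const_smul (c x)
  -- The cross term of the product rule: a bounded difference quotient times an increment that tends
  -- to zero.
  have h3 : Tendsto (fun y => (((‖y - x‖⁻¹ : ℝ) : ℂ) * c' (y - x)) • (f y - f x)) (𝓝 x) (𝓝 0) := by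
    refine tendsto_bounded_smul_zero (M := ‖c'‖) (fun y => ?_) ?_
    · rw [norm_mul, Complex.norm_real, norm_inv, norm_norm, inv_mul_eq_div]
      exact c'.ratio_le_opNorm _
    · simpa using hfc.tendsto.sub_const (f x)
  have h4 := (h1.add h2).add h3
  simp only [zero_smul, smul_zero, add_zero] at h4
  refine h4.congr fun y => ?_
  rw [hh]
  simp only [← Complex.coe_smul, smul_eq_mul]
  module

omit [IsTopologicalAddGroup V] [IsTopologicalAddGroup W] in
theorem hasFDerivAt_clm_comp_tvs (L : V →L[ℂ] W) {f : E → V} {f' : E →L[ℝ] V} {x : E}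
    (hf : HasFDerivAt f f' x) :
    HasFDerivAt (fun y => L (f y)) ((L.restrictScalars ℝ).comp f') x := by
  rw [hasFDerivAt_iff_tendsto_inv_norm_smul] at hf ⊢
  have := (L.continuous.tendsto 0).comp hf
  rw [map_zero] at this
  refine this.congr fun y => ?_
  simp only [Function.comp, ← Complex.coe_smul]
  simp

theorem hasFDerivAt_add_tvs {f g : E → V} {f' g' : E →L[ℝ] V} {x : E}
    (hf : HasFDerivAt f f' x) (hg : HasFDerivAt g g' x) :
    HasFDerivAt (fun y => f y + g y) (f' + g') x := by
  rw [hasFDerivAt_iff_tendsto_inv_norm_smul] at *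
  have := hf.add hg
  rw [add_zero] at this
  refine this.congr fun y => ?_
  rw [← smul_add]
  congr 1
  simp only [add_apply]
  abel

omit [IsTopologicalAddGroup V] in
theorem hasFDerivAt_pi_tvs {ι : Type*} {f : E → ι → V} {f' : E →L[ℝ] (ι → V)} {x : E}
    (hf : ∀ i, HasFDerivAt (fun y => f y i) ((ContinuousLinearMap.proj i).comp f') x) :
    HasFDerivAt f f' x := by
  simp only [hasFDerivAt_iff_tendsto_inv_norm_smul] at *
  exact tendsto_pi_nhds.2 hf

theorem hasFDerivAt_unique_tvs [T2Space V] {f : E → V} {f' g' : E →L[ℝ] V} {x : E}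
    (hf : HasFDerivAt f f' x) (hg : HasFDerivAt f g' x) : f' = g' :=
  have : ContinuousSMul ℝ V := continuousSMul_real
  hf.unique hg

theorem hasFDerivAt_tendsto_slope {f : E → V} {f' : E →L[ℝ] V} {x : E}
    (hf : HasFDerivAt f f' x) (A : E) :
    Tendsto (fun t : ℝ => t⁻¹ • (f (x + t • A) - f x)) (𝓝[≠] 0) (𝓝 (f' A)) := by
  have : ContinuousSMul ℝ V := continuousSMul_real
  refine (hasFDerivWithinAt_univ.2 hf).lim (d := fun t : ℝ => t • A) ?_ (by simp) ?_
  · have : Tendsto (fun t : ℝ => t • A) (𝓝 0) (𝓝 ((0 : ℝ) • A)) :=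
      (continuous_id.smul continuous_const).tendsto 0
    rw [zero_smul] at this
    exact this.mono_left nhdsWithin_le_nhds
  · refine tendsto_const_nhds.congr' ?_
    filter_upwards [self_mem_nhdsWithin] with t ht
    rw [smul_smul, inv_mul_cancel₀ ht, one_smul]

end TVS

/-! ### Second derivatives along left-invariant vector fields -/

section GroupCalculus

open Filter

variable {G : Type v} [Group G] [TopologicalSpace G] [ChartedSpace (EuclideanSpace ℝ (Fin 3)) G]

local notation "E₃" => EuclideanSpace ℝ (Fin 3)

variable (G) in
/-- The coordinates of the identity in the preferred chart. -/
def basePt : E₃ := extChartAt (𝓡 3) (1 : G) 1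

lemma extChartAt_symm_basePt : (extChartAt (𝓡 3) (1 : G)).symm (basePt G) = 1 :=
  extChartAt_to_inv (I := 𝓡 3) (1 : G)

lemma param_basePt (g : G) : param g (basePt G) = g := by
  rw [param, extChartAt_symm_basePt, mul_one]

lemma param_eq_mul (g : G) (x : E₃) : param g x = g * param 1 x := by simp [param]

variable [LieGroup (𝓡 3) ∞ G]

/-- The coordinates of `g⁻¹ h` in terms of those of `g` and `h`. -/
def relCoord (p : E₃ × E₃) : E₃ :=
  extChartAt (𝓡 3) (1 : G)
    (((extChartAt (𝓡 3) (1 : G)).symm p.1)⁻¹ * (extChartAt (𝓡 3) (1 : G)).symm p.2)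

lemma contMDiffAt_param_one : ContMDiffAt 𝓘(ℝ, E₃) (𝓡 3) ∞
    (extChartAt (𝓡 3) (1 : G)).symm (basePt G) :=
  (contMDiffOn_extChartAt_symm (I := 𝓡 3) (n := ∞) (1 : G)).contMDiffAt
    (extChartAt_target_mem_nhds (I := 𝓡 3) (1 : G))

variable (G) in
lemma contDiffAt_relCoord : ContDiffAt ℝ ∞ (relCoord (G := G)) (basePt G, basePt G) := by
  rw [← contMDiffAt_iff_contDiffAt]
  have h1 : ContMDiffAt 𝓘(ℝ, E₃ × E₃) (𝓡 3) ∞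
      (fun p : E₃ × E₃ => (extChartAt (𝓡 3) (1 : G)).symm p.1) (basePt G, basePt G) :=
    ContMDiffAt.comp (basePt G, basePt G) contMDiffAt_param_one
      (contDiff_fst.contMDiff.contMDiffAt)
  have h2 : ContMDiffAt 𝓘(ℝ, E₃ × E₃) (𝓡 3) ∞
      (fun p : E₃ × E₃ => (extChartAt (𝓡 3) (1 : G)).symm p.2) (basePt G, basePt G) :=
    ContMDiffAt.comp (basePt G, basePt G) contMDiffAt_param_one
      (contDiff_snd.contMDiff.contMDiffAt)
  have h3 := h1.inv.mul h2
  refine ContMDiffAt.comp (I' := 𝓡 3) (basePt G, basePt G) ?_ h3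
  simp only [extChartAt_symm_basePt, inv_one, one_mul]
  exact contMDiffAt_extChartAt

/-- The left-invariant frame in coordinates, inverted: the derivative at `h = g` of the
coordinates of `g⁻¹ h`. -/
def coframe (x : E₃) : E₃ →L[ℝ] E₃ :=
  (fderiv ℝ (relCoord (G := G)) (x, x)).comp (ContinuousLinearMap.inr ℝ E₃ E₃)

variable (G) in
lemma differentiableAt_coframe : DifferentiableAt ℝ (coframe (G := G)) (basePt G) := by
  have h1 : ContDiffAt ℝ 1 (fderiv ℝ (relCoord (G := G))) (basePt G, basePt G) :=
    (contDiffAt_relCoord G).fderiv_right (by norm_cast)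
  have h2 : DifferentiableAt ℝ (fun x : E₃ => fderiv ℝ (relCoord (G := G)) (x, x)) (basePt G) :=
    DifferentiableAt.comp (basePt G) (h1.differentiableAt one_ne_zero)
      (differentiableAt_id.prodMk differentiableAt_id)
  exact h2.clm_comp (differentiableAt_const _)

variable (G) in
lemma eventually_hasFDerivAt_relCoord : ∀ᶠ x in 𝓝 (basePt G),
    HasFDerivAt (fun z => relCoord (G := G) (x, z)) (coframe (G := G) x) x := by
  have h0 : ContDiffAt ℝ 1 (relCoord (G := G)) (basePt G, basePt G) :=
    (contDiffAt_relCoord G).of_le (by norm_cast)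
  have h1 : ∀ᶠ p in 𝓝 (basePt G, basePt G), DifferentiableAt ℝ (relCoord (G := G)) p :=
    (h0.eventually (by simp)).mono fun p hp => hp.differentiableAt one_ne_zero
  have h2 : Tendsto (fun x : E₃ => (x, x)) (𝓝 (basePt G)) (𝓝 (basePt G, basePt G)) :=
    (continuous_id.prodMk continuous_id).tendsto _
  filter_upwards [h2.eventually h1] with x hx
  exact hx.hasFDerivAt.comp x (hasFDerivAt_prodMk_right x x)

lemma coframe_basePt : coframe (G := G) (basePt G) = ContinuousLinearMap.id ℝ E₃ := by
  have h1 := (eventually_hasFDerivAt_relCoord G).self_of_nhds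
  refine h1.unique ((hasFDerivAt_id _).congr_of_eventuallyEq ?_)
  filter_upwards [extChartAt_target_mem_nhds (I := 𝓡 3) (1 : G)] with z hz
  simp only [relCoord, extChartAt_symm_basePt, inv_one, one_mul, id]
  exact (extChartAt (𝓡 3) (1 : G)).right_inv hz

omit [LieGroup (𝓡 3) ∞ G] in
lemma relCoord_self (x : E₃) : relCoord (G := G) (x, x) = basePt G := by
  simp [relCoord, basePt]

/-- This is `g (g⁻¹ h) = h`, valid in coordinates while `g⁻¹ h` stays in the chart at the identity.
-/
lemma eventually_param_relCoord : ∀ᶠ x in 𝓝 (basePt G), ∀ᶠ z in 𝓝 x,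
    param (param (1 : G) x) (relCoord (G := G) (x, z)) = param 1 z := by
  have : IsTopologicalGroup G := topologicalGroup_of_lieGroup (𝓡 3) ∞
  filter_upwards [extChartAt_target_mem_nhds (I := 𝓡 3) (1 : G),
    eventually_mem_nhds_iff.2 (extChartAt_target_mem_nhds (I := 𝓡 3) (1 : G))] with x hx hx'
  have hc : ContinuousAt (extChartAt (𝓡 3) (1 : G)).symm x :=
    (continuousOn_extChartAt_symm (I := 𝓡 3) (1 : G)).continuousAt hx'
  have h2 : Tendsto (fun z => ((extChartAt (𝓡 3) (1 : G)).symm x)⁻¹ *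
      (extChartAt (𝓡 3) (1 : G)).symm z) (𝓝 x) (𝓝 1) := by
    have := hc.tendsto.const_mul (((extChartAt (𝓡 3) (1 : G)).symm x)⁻¹)
    rwa [inv_mul_cancel] at this
  filter_upwards [h2.eventually (extChartAt_source_mem_nhds (I := 𝓡 3) (1 : G))] with z hz
  simp only [param, relCoord, one_mul]
  rw [(extChartAt (𝓡 3) (1 : G)).left_inv hz, mul_inv_cancel_left]

variable (G) in
/-- The structure constants of the Lie algebra of `G`, in coordinates. -/
def commutator (B A : E₃) : E₃ :=
  fderiv ℝ (coframe (G := G)) (basePt G) A B - fderiv ℝ (coframe (G := G)) (basePt G) B A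

/-- The commutator of two derivatives along left-invariant vector fields. -/
theorem commutator_of_second_derivatives {W : Type*} [NormedAddCommGroup W] [NormedSpace ℝ W]
    {F : G → W} {F' : G → E₃ →L[ℝ] W} {F'' : E₃ → E₃ →L[ℝ] W}
    (h1 : ∀ g, HasFDerivAt (fun x => F (param g x)) (F' g) (basePt G))
    (h2 : ∀ A, HasFDerivAt (fun x => F' (param 1 x) A) (F'' A) (basePt G)) (A B : E₃) :
    F'' A B - F'' B A = F' 1 (commutator G B A) := by
  -- Near the base point, the ordinary derivative in the chart is the left-invariant derivative
  -- composed with the coframe.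
  have e1 : ∀ᶠ x in 𝓝 (basePt G), HasFDerivAt (fun z => F (param 1 z))
      ((F' (param 1 x)).comp (coframe (G := G) x)) x := by
    filter_upwards [eventually_hasFDerivAt_relCoord G, eventually_param_relCoord (G := G)]
      with x hx hx'
    have := h1 (param 1 x)
    rw [← relCoord_self (G := G) x] at this
    refine (HasFDerivAt.comp x this hx).congr_of_eventuallyEq ?_
    filter_upwards [hx'] with z hz
    simp [hz]
  let b := EuclideanSpace.basisFun (Fin 3) ℝ
  -- The hypothesis differentiates `F'` only in each fixed direction; a finite basis assembles these
  -- into the derivative of the operator-valued map.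
  let D : E₃ →L[ℝ] E₃ →L[ℝ] W := ∑ k, (ContinuousLinearMap.smulRightL ℝ E₃ W
    (EuclideanSpace.proj k)).comp (F'' (b k))
  have hsum : ∀ (L : E₃ →L[ℝ] W) (v : E₃), L v = ∑ k, v k • L (b k) := fun L v => by
    conv_lhs => rw [← b.sum_repr v]
    simp [b]
  have e2 : HasFDerivAt (fun x => F' (param 1 x)) D (basePt G) := by
    have : (fun x => F' (param (1 : G) x)) = fun x => ∑ k, ContinuousLinearMap.smulRightL ℝ E₃ W
        (EuclideanSpace.proj k) (F' (param 1 x) (b k)) := by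
      funext x
      ext v
      rw [hsum]
      simp
    rw [this]
    exact HasFDerivAt.fun_sum fun k _ =>
      (ContinuousLinearMap.hasFDerivAt _).comp _ (h2 (b k))
  have hD : ∀ A B, D B A = F'' A B := fun A B => by
    have e3 : HasFDerivAt (fun x => F' (param 1 x) A) (D.flip A) (basePt G) := by
      simpa using e2.clm_apply (hasFDerivAt_const A (basePt G))
    rw [(h2 A).unique e3]
    rfl
  have e4 := e2.clm_comp (differentiableAt_coframe G).hasFDerivAt
  -- Symmetry of the second derivative in the chart: the derivative of the coframe contributes
  -- exactly the structure constants.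
  have e5 := second_derivative_symmetric_of_eventually e1 e4 B A
  simp only [add_apply, ContinuousLinearMap.comp_apply,
    ContinuousLinearMap.compL_apply, ContinuousLinearMap.flip_apply, coframe_basePt,
    param_basePt, ContinuousLinearMap.id_apply, hD] at e5
  rw [commutator, map_sub]
  rw [sub_eq_sub_iff_add_eq_add, add_comm]
  exact e5

end GroupCalculus

/-! ### The infinitesimal action -/

section Action

open Filter

variable {G : Type v} [Group G] [TopologicalSpace G] [ChartedSpace (EuclideanSpace ℝ (Fin 3)) G]

local notation "E₃" => EuclideanSpace ℝ (Fin 3)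

/-- The derivatives at the identity of all orbit maps exist. -/
def FrechetRep.OrbitDifferentiable (P : FrechetRep.{u} G) : Prop :=
  ∀ w : P.V, DifferentiableAt ℝ (fun x => P.ρ (param (1 : G) x) w) (basePt G)

lemma FrechetRep.IsSmooth.orbitDifferentiable {P : FrechetRep.{u} G} (hP : P.IsSmooth) :
    P.OrbitDifferentiable := fun w => by
  obtain ⟨-, f', hf', -⟩ := hP w 1
  exact ⟨f' 1, hf' 1⟩

namespace FrechetRep

variable {P : FrechetRep.{u} G}

/-- The derivative `dρ` as a continuous linear map of the direction. -/
def dρL (P : FrechetRep.{u} G) (w : P.V) : E₃ →L[ℝ] P.V :=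
  fderiv ℝ (fun x => P.ρ (param (1 : G) x) w) (basePt G)

lemma OrbitDifferentiable.hasFDerivAt (hP : P.OrbitDifferentiable) (w : P.V) :
    HasFDerivAt (fun x => P.ρ (param (1 : G) x) w) (P.dρL w) (basePt G) :=
  (hP w).hasFDerivAt

lemma dρL_eq {w : P.V} {L : E₃ →L[ℝ] P.V}
    (h : HasFDerivAt (fun x => P.ρ (param (1 : G) x) w) L (basePt G)) : P.dρL w = L :=
  hasFDerivAt_unique_tvs (DifferentiableAt.hasFDerivAt ⟨L, h⟩) h

lemma OrbitDifferentiable.hasFDerivAt_translate (hP : P.OrbitDifferentiable) (g : G) (w : P.V) :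
    HasFDerivAt (fun x => P.ρ (param g x) w) (((P.ρ g).restrictScalars ℝ).comp (P.dρL w))
      (basePt G) := by
  simp_rw [param_eq_mul g, map_mul]
  exact hasFDerivAt_clm_comp_tvs (P.ρ g) (hP.hasFDerivAt w)

lemma OrbitDifferentiable.dρL_add (hP : P.OrbitDifferentiable) (w z : P.V) :
    P.dρL (w + z) = P.dρL w + P.dρL z := by
  refine dρL_eq ?_
  simp_rw [map_add]
  exact hasFDerivAt_add_tvs (hP.hasFDerivAt w) (hP.hasFDerivAt z)

lemma OrbitDifferentiable.dρL_smul (hP : P.OrbitDifferentiable) (c : ℂ) (w : P.V) (A : E₃) :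
    P.dρL (c • w) A = c • P.dρL w A := by
  have := hasFDerivAt_clm_comp_tvs (c • ContinuousLinearMap.id ℂ P.V) (hP.hasFDerivAt w)
  have h2 : P.dρL (c • w) = _ := dρL_eq (by simpa using this)
  rw [h2]
  simp

variable [LieGroup (𝓡 3) ∞ G]

/-- The commutation relation between derivatives of a representation. -/
theorem OrbitDifferentiable.dρL_commutator (hP : P.OrbitDifferentiable) (w : P.V) (A B : E₃) :
    P.dρL (P.dρL w A) B - P.dρL (P.dρL w B) A = P.dρL w (commutator G B A) := by
  by_contra hne
  -- The symmetry theorem needs normed values. Continuous functionals separate points of a locally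
  -- convex Hausdorff space, so scalar coefficients suffice.
  obtain ⟨l, hl⟩ := RCLike.geometric_hahn_banach_point_point (𝕜 := ℂ) hne
  refine hl.ne (congrArg Complex.re ?_)
  have := commutator_of_second_derivatives (G := G) (F := fun g => l (P.ρ g w))
    (F' := fun g => ((l.comp (P.ρ g)).restrictScalars ℝ).comp (P.dρL w))
    (F'' := fun A => (l.restrictScalars ℝ).comp (P.dρL (P.dρL w A)))
    (fun g => hasFDerivAt_clm_comp_tvs l (hP.hasFDerivAt_translate g w))
    (fun A => hasFDerivAt_clm_comp_tvs l (hP.hasFDerivAt (P.dρL w A))) A B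
  simpa using this

end FrechetRep

variable [LieGroup (𝓡 3) ∞ G] (S : SL2Group G)

namespace SL2Group

/-- The differential of the matrix coefficients of `φ`. -/
def dφ (i j : Fin 2) : E₃ →L[ℝ] ℂ :=
  fderiv ℝ (fun x => (S.φ (param 1 x)).val i j) (basePt G)

lemma hasFDerivAt_coeff (i j : Fin 2) :
    HasFDerivAt (fun x => (S.φ (param 1 x)).val i j) (S.dφ i j) (basePt G) := by
  have h1 : ContMDiffAt 𝓘(ℝ, E₃) 𝓘(ℝ, ℂ) ∞
      (fun x => (S.φ ((extChartAt (𝓡 3) (1 : G)).symm x)).val i j) (basePt G) :=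
    ContMDiffAt.comp (basePt G) (S.smooth i j).contMDiffAt contMDiffAt_param_one
  have h2 : DifferentiableAt ℝ (fun x => (S.φ (param 1 x)).val i j) (basePt G) := by
    simp only [param, one_mul]
    exact (contMDiffAt_iff_contDiffAt.1 h1).differentiableAt (by simp)
  exact h2.hasFDerivAt

/-- The inclusion of `𝔤`, in coordinates, into `𝔰𝔩(2, ℂ)`. -/
def incl (A : E₃) : sl2 := S.Φ (1 ⊗ₜ[ℝ] (show LieAlg G from A))

lemma dφ_eq (A : E₃) (i j : Fin 2) : S.dφ i j A = (S.incl A).val i j := by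
  rw [incl, ← S.differential, ((S.smooth i j).mdifferentiable (by simp) 1).mfderiv]
  simp [dφ, param, writtenInExtChartAt, Function.comp_def, basePt]
  rfl

/-- The general commutator formula applied to the matrix coefficients of `φ`, whose iterated
left-invariant derivatives at the identity are entries of matrix products. The bracket on the Lie
algebra of `G` is not needed. -/
lemma commutator_eq (A B : E₃) : S.incl (commutator G B A) = ⁅S.incl B, S.incl A⁆ := by
  apply Subtype.ext
  ext i j
  have := commutator_of_second_derivatives (G := G) (F := fun g => (S.φ g).val i j)
    (F' := fun g => ∑ k, (S.φ g).val i k • S.dφ k j)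
    (F'' := fun A => ∑ k, S.dφ k j A • S.dφ i k) (fun g => ?_) (fun A => ?_) A B
  · simp only [map_one, Fin.sum_univ_two] at this
    simp only [LieAlgebra.SpecialLinear.sl_bracket, Matrix.sub_apply, Matrix.mul_apply,
      Fin.sum_univ_two, ← dφ_eq]
    simp only [add_apply, smul_apply, smul_eq_mul, Matrix.SpecialLinearGroup.coe_one] at this
    fin_cases i <;> simp [Matrix.one_apply] at this ⊢ <;> linear_combination -this
  · simp_rw [param_eq_mul g, map_mul, Matrix.SpecialLinearGroup.coe_mul, Matrix.mul_apply]
    exact HasFDerivAt.fun_sum fun k _ => (S.hasFDerivAt_coeff k j).const_mul _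
  · simp only [sum_apply, smul_apply, smul_eq_mul]
    exact HasFDerivAt.fun_sum fun k _ => (S.hasFDerivAt_coeff i k).mul_const _

/-- A property of elements of `𝔰𝔩(2, ℂ)` which is stable under linear combinations holds
everywhere if it holds on the real Lie algebra `𝔤`. -/
lemma induction_real {p : sl2 → Prop} (hreal : ∀ A : E₃, p (S.incl A))
    (hadd : ∀ Z W, p Z → p W → p (Z + W)) (hsmul : ∀ (c : ℂ) Z, p Z → p (c • Z)) (Z : sl2) :
    p Z := by
  obtain ⟨t, rfl⟩ := S.Φ.surjective Z
  induction t with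
  | zero => simpa using hsmul 0 _ (hreal 0)
  | tmul c A =>
    have : c ⊗ₜ[ℝ] A = c • ((1 : ℂ) ⊗ₜ[ℝ] A) := by simp [TensorProduct.smul_tmul']
    rw [this, map_smul]
    exact hsmul _ _ (hreal A)
  | add s t hs ht =>
    rw [map_add]
    exact hadd _ _ hs ht

end SL2Group

namespace FrechetRep

variable {S} {P P' P'' Q : FrechetRep.{u} G}

lemma act_real (P : FrechetRep.{u} G) (A : E₃) (w : P.V) :
    P.act S (S.incl A) w = P.dρL w A := by
  rw [act, SL2Group.incl, LieEquiv.symm_apply_apply]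
  exact (LinearMap.liftBaseChange_tmul ..).trans (one_smul ℂ _)

lemma act_add_left (P : FrechetRep.{u} G) (Z W : sl2) (w : P.V) :
    P.act S (Z + W) w = P.act S Z w + P.act S W w := by simp [act]

lemma act_smul_left (P : FrechetRep.{u} G) (c : ℂ) (Z : sl2) (w : P.V) :
    P.act S (c • Z) w = c • P.act S Z w := by simp [act]

lemma OrbitDifferentiable.act_add (hP : P.OrbitDifferentiable) (Z : sl2) (w z : P.V) :
    P.act S Z (w + z) = P.act S Z w + P.act S Z z := by
  refine S.induction_real (p := fun Z => P.act S Z (w + z) = P.act S Z w + P.act S Z z)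
    (fun A => ?_) (fun Z W h1 h2 => ?_) (fun c Z h => ?_) Z
  · simp only [act_real, hP.dρL_add, add_apply]
  · simp only [act_add_left, h1, h2]; abel
  · simp only [act_smul_left, h, smul_add]

lemma OrbitDifferentiable.act_smul (hP : P.OrbitDifferentiable) (Z : sl2) (a : ℂ) (w : P.V) :
    P.act S Z (a • w) = a • P.act S Z w := by
  refine S.induction_real (p := fun Z => P.act S Z (a • w) = a • P.act S Z w)
    (fun A => ?_) (fun Z W h1 h2 => ?_) (fun c Z h => ?_) Z
  · simp only [act_real, hP.dρL_smul]
  · simp only [act_add_left, h1, h2, smul_add]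
  · simp only [act_smul_left, h, smul_comm c a]

theorem OrbitDifferentiable.act_act_sub (hP : P.OrbitDifferentiable) (Z W : sl2) (w : P.V) :
    P.act S Z (P.act S W w) - P.act S W (P.act S Z w) = P.act S ⁅Z, W⁆ w := by
  refine S.induction_real (p := fun Z => P.act S Z (P.act S W w) - P.act S W (P.act S Z w) =
    P.act S ⁅Z, W⁆ w) (fun B => ?_) (fun Z Z' h1 h2 => ?_) (fun c Z h => ?_) Z
  · refine S.induction_real (p := fun W => P.act S (S.incl B) (P.act S W w) -
      P.act S W (P.act S (S.incl B) w) = P.act S ⁅S.incl B, W⁆ w)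
      (fun A => ?_) (fun W W' h1 h2 => ?_) (fun c W h => ?_) W
    · rw [← S.commutator_eq]
      simp only [act_real]
      exact hP.dρL_commutator w A B
    · rw [lie_add]
      simp only [act_add_left, hP.act_add, ← h1, ← h2]
      abel
    · rw [lie_smul]
      simp only [act_smul_left, hP.act_smul, ← h, smul_sub]
  · rw [add_lie]
    simp only [act_add_left, hP.act_add, ← h1, ← h2]
    abel
  · rw [smul_lie]
    simp only [act_smul_left, hP.act_smul, ← h, smul_sub]

/-- Invariant bilinear maps are invariant under the Lie algebra. -/
theorem act_homG (hP' : P'.OrbitDifferentiable) (hP'' : P''.OrbitDifferentiable)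
    (hQ : Q.OrbitDifferentiable) {T : P'.V →ₗ[ℂ] P''.V →ₗ[ℂ] Q.V} (hT : T ∈ homG P' P'' Q)
    (Z : sl2) (a : P'.V) (b : P''.V) :
    Q.act S Z (T a b) = T (P'.act S Z a) b + T a (P''.act S Z b) := by
  refine S.induction_real (p := fun Z => Q.act S Z (T a b) =
    T (P'.act S Z a) b + T a (P''.act S Z b))
    (fun A => ?_) (fun Z W h1 h2 => ?_) (fun c Z h => ?_) Z
  · simp only [act_real]
    have h1 := hasFDerivAt_tendsto_slope (hP'.hasFDerivAt a) A
    have h2 := hasFDerivAt_tendsto_slope (hP''.hasFDerivAt b) A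
    have h3 := hasFDerivAt_tendsto_slope (hQ.hasFDerivAt (T a b)) A
    -- Continuity along the curve, recovered from the convergent difference quotient by multiplying
    -- with `t`.
    have h4 : Tendsto (fun t : ℝ => P''.ρ (param 1 (basePt G + t • A)) b) (𝓝[≠] 0) (𝓝 b) := by
      have : ContinuousSMul ℝ P''.V := continuousSMul_real
      have h5 : Tendsto (fun t : ℝ => t) (𝓝[≠] 0) (𝓝 0) := tendsto_id.mono_left nhdsWithin_le_nhds
      have h6 := (h5.smul h2).add_const b
      rw [zero_smul, zero_add] at h6
      refine h6.congr' ?_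
      filter_upwards [self_mem_nhdsWithin] with t ht
      rw [smul_smul, mul_inv_cancel₀ ht, one_smul, param_basePt, map_one]
      simp
    refine tendsto_nhds_unique h3 ?_
    have h7 := ((hT.1.tendsto _).comp (h1.prodMk_nhds h4)).add
      ((hT.1.tendsto _).comp ((tendsto_const_nhds (x := a)).prodMk_nhds h2))
    refine h7.congr fun t => ?_
    simp only [Function.comp, param_basePt, map_one, ← Complex.coe_smul, map_smul,
      LinearMap.smul_apply, map_sub, LinearMap.sub_apply, ← hT.2]
    simp only [one_apply_eq_self, smul_sub]
    abel
  · simp only [act_add_left, h1, h2, map_add, LinearMap.add_apply]; abel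
  · simp only [act_smul_left, h, smul_add, map_smul, LinearMap.smul_apply]

lemma OrbitDifferentiable.hasFDerivAt_tensorC2 (hP : P.OrbitDifferentiable) (w : Fin 2 → P.V) :
    ∃ L : E₃ →L[ℝ] (Fin 2 → P.V),
      HasFDerivAt (fun x => P.tensorAct S (param (1 : G) x) w) L (basePt G) ∧
      ∀ A i, L A i = ∑ j, S.dφ i j A • w j + P.dρL (w i) A := by
  have : ContinuousSMul ℝ P.V := continuousSMul_real
  let M (i j : Fin 2) : E₃ →L[ℝ] P.V := (S.dφ i j).smulRight (w j) +
    (S.φ (param 1 (basePt G))).val i j • P.dρL (w j)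
  have h1 (i j : Fin 2) : HasFDerivAt (fun x => (S.φ (param 1 x)).val i j • P.ρ (param 1 x) (w j))
      (M i j) (basePt G) :=
    hasFDerivAt_smul_tvs (S.hasFDerivAt_coeff i j) (hP.hasFDerivAt (w j)) fun v => by
      simp [M, param_basePt]
  refine ⟨ContinuousLinearMap.pi fun i => M i 0 + M i 1, ?_, fun A i => ?_⟩
  · refine hasFDerivAt_pi_tvs fun i => ?_
    simp only [tensorAct_apply, Fin.sum_univ_two]
    exact hasFDerivAt_add_tvs (h1 i 0) (h1 i 1)
  · simp only [ContinuousLinearMap.pi_apply, add_apply, M, param_basePt, map_one,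
      ContinuousLinearMap.smulRight_apply, smul_apply, Fin.sum_univ_two]
    fin_cases i <;> simp <;> abel

variable (S) in
/-- The action of `𝔰𝔩(2, ℂ)` on `P ⊗ ℂ²`. -/
def actTensor (P : FrechetRep.{u} G) (Z : sl2) (w : Fin 2 → P.V) : Fin 2 → P.V :=
  (P.tensorC2 S).act S Z w

/-- The Leibniz rule for the action on `P ⊗ ℂ²`. -/
theorem OrbitDifferentiable.actTensor_apply (hP : P.OrbitDifferentiable) (Z : sl2)
    (w : Fin 2 → P.V) (i : Fin 2) :
    P.actTensor S Z w i = ∑ j, Z.val i j • w j + P.act S Z (w i) := by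
  refine S.induction_real (p := fun Z => P.actTensor S Z w i =
    ∑ j, Z.val i j • w j + P.act S Z (w i)) (fun A => ?_) (fun Z W h1 h2 => ?_) (fun c Z h => ?_) Z
  · obtain ⟨L, hL, hL'⟩ := hP.hasFDerivAt_tensorC2 (S := S) w
    have h1 : (P.tensorC2 S).dρL w = L := dρL_eq hL
    have h2 : P.actTensor S (S.incl A) w = L A := by
      rw [← h1]
      exact act_real (P.tensorC2 S) A w
    rw [h2, hL', act_real]
    simp only [SL2Group.dφ_eq]
  · have h3 : P.actTensor S (Z + W) w = P.actTensor S Z w + P.actTensor S W w :=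
      act_add_left (P.tensorC2 S) Z W w
    rw [act_add_left, h3, Pi.add_apply, h1, h2]
    have hv (j : Fin 2) : (Z + W).val i j = Z.val i j + W.val i j := rfl
    simp only [Fin.sum_univ_two, hv, add_smul]
    abel
  · have h3 : P.actTensor S (c • Z) w = c • P.actTensor S Z w :=
      act_smul_left (P.tensorC2 S) c Z w
    rw [act_smul_left, h3, Pi.smul_apply, h]
    have hv (j : Fin 2) : (c • Z).val i j = c * Z.val i j := rfl
    simp only [Fin.sum_univ_two, hv, smul_add, smul_smul]

end FrechetRep
end Action

/-! ### Translation to neighbouring parameters -/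

section Translation

lemma lie_H_X : ⁅H, X⁆ = (2 : ℂ) • X := by
  apply Subtype.ext
  ext i j
  fin_cases i <;> fin_cases j <;> simp [Ring.lie_def, H, X, one_add_one_eq_two]

lemma lie_H_Y : ⁅H, Y⁆ = (-2 : ℂ) • Y := by
  apply Subtype.ext
  ext i j
  fin_cases i <;> fin_cases j <;> simp [Ring.lie_def, H, Y]
  norm_num

lemma lie_X_Y : ⁅X, Y⁆ = H := by
  apply Subtype.ext
  ext i j
  fin_cases i <;> fin_cases j <;> simp [Ring.lie_def, H, X, Y]

variable {G : Type v} [Group G] [TopologicalSpace G] [ChartedSpace (EuclideanSpace ℝ (Fin 3)) G]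
  [LieGroup (𝓡 3) ∞ G] {S : SL2Group G}

namespace FrechetRep

variable {P P' P'' Q : FrechetRep.{u} G}

variable (S) in
/-- The Casimir element on `P ⊗ ℂ²`. -/
def casimirTensor (P : FrechetRep.{u} G) (w : Fin 2 → P.V) : Fin 2 → P.V :=
  (P.tensorC2 S).casimir S w

/-- The Casimir element acts by `l² - 1` on `P` and by `3` on `ℂ²`; the remaining terms are `2L`
with `L = H ⊗ H + 2 (X ⊗ Y + Y ⊗ X)`. -/
lemma OrbitDifferentiable.casimirTensor_eq (hP : P.OrbitDifferentiable) {l : ℂ}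
    (hl : P.HasInfChar S l) (x y : P.V) :
    P.casimirTensor S ![x, y] =
      ![(l ^ 2 + 2) • x + (2 : ℂ) • P.act S H x + (4 : ℂ) • P.act S Y y,
        (l ^ 2 + 2) • y - (2 : ℂ) • P.act S H y + (4 : ℂ) • P.act S X x] := by
  have hdef (w : Fin 2 → P.V) : P.casimirTensor S w =
      P.actTensor S H (P.actTensor S H w) + (2 : ℂ) • (P.actTensor S X (P.actTensor S Y w) +
        P.actTensor S Y (P.actTensor S X w)) := rfl
  have hx := hl x
  have hy := hl y
  rw [casimir] at hx hy
  have hneg (Z : sl2) (v : P.V) : P.act S Z (-v) = -P.act S Z v := by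
    simpa using hP.act_smul (S := S) Z (-1) v
  funext i
  fin_cases i
  · simp [hdef, hP.actTensor_apply, Fin.sum_univ_two, H, X, Y, hP.act_add]
    -- The matrices were unfolded for their entries on `ℂ²`; those acting on `P` are folded back.
    simp only [← H.eq_1, ← X.eq_1, ← Y.eq_1]
    linear_combination (norm := module) hx
  · simp [hdef, hP.actTensor_apply, Fin.sum_univ_two, H, X, Y, hP.act_add, hneg]
    simp only [← H.eq_1, ← X.eq_1, ← Y.eq_1]
    linear_combination (norm := module) hy

/-- The primary component of `P ⊗ ℂ²` for `l + 1` contains the images of `a ⊗ f₊` and `a ⊗ f₋`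
under `L + 1 + l`, where `L = H ⊗ H + 2 (X ⊗ Y + Y ⊗ X)`. -/
lemma OrbitDifferentiable.mem_primary (hP : P.OrbitDifferentiable) {l : ℂ}
    (hl : P.HasInfChar S l) (a : P.V) :
    ![P.act S H a + (1 + l) • a, (2 : ℂ) • P.act S X a] ∈ (P.tensorC2 S).primary S (l + 1) ∧
    ![(2 : ℂ) • P.act S Y a, (1 + l) • a - P.act S H a] ∈ (P.tensorC2 S).primary S (l + 1) := by
  have ha := hl a
  rw [casimir] at ha
  have hHX := hP.act_act_sub (S := S) H X a
  have hHY := hP.act_act_sub (S := S) H Y a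
  have hXY := hP.act_act_sub (S := S) X Y a
  rw [lie_H_X, act_smul_left] at hHX
  rw [lie_H_Y, act_smul_left] at hHY
  rw [lie_X_Y] at hXY
  have hneg (Z : sl2) (v w : P.V) : P.act S Z (v - w) = P.act S Z v - P.act S Z w := by
    have := hP.act_add (S := S) Z v ((-1 : ℂ) • w)
    rw [hP.act_smul] at this
    simpa [sub_eq_add_neg] using this
  -- Since `(L + 1 - l)(L + 1 + l) = 0`, the image of `L + 1 + l` consists of genuine eigenvectors,
  -- so exponent 1 suffices.
  have key (w : Fin 2 → P.V) (hw : P.casimirTensor S w = fun i => ((l + 1) ^ 2 - 1) • w i) :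
      w ∈ (P.tensorC2 S).primary S (l + 1) := by
    refine ⟨1, sub_eq_zero.2 ?_⟩
    exact hw.trans (funext fun _ => rfl)
  constructor
  · apply key
    rw [hP.casimirTensor_eq hl]
    simp only [hP.act_add, hP.act_smul]
    funext i
    fin_cases i <;> simp
    · linear_combination (norm := module) (2 : ℂ) • ha - (4 : ℂ) • hXY
    · linear_combination (norm := module) (-4 : ℂ) • hHX
  · apply key
    rw [hP.casimirTensor_eq hl]
    simp only [hP.act_smul, hneg]
    funext i
    fin_cases i <;> simp
    · linear_combination (norm := module) (4 : ℂ) • hHY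
    · linear_combination (norm := module) (2 : ℂ) • ha + (4 : ℂ) • hXY


/-- The map `Hom_G(P' ⊠ P'', Q) → Hom_G(R' ⊠ R'', Q)` given by maps `R' → P' ⊗ ℂ²` and
`R'' → P'' ⊗ ℂ²` and the invariant symplectic form on `ℂ²`. -/
def contract {R' R'' : FrechetRep.{u} G} (j' : ContIntertwiningMap R'.ρ (P'.tensorC2 S).ρ)
    (j'' : ContIntertwiningMap R''.ρ (P''.tensorC2 S).ρ) : homG P' P'' Q →ₗ[ℂ] homG R' R'' Q :=
  let p' (i : Fin 2) : R'.V →L[ℂ] P'.V :=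
    (ContinuousLinearMap.proj (φ := fun _ : Fin 2 => P'.V) i).comp j'.toContinuousLinearMap
  let p'' (i : Fin 2) : R''.V →L[ℂ] P''.V :=
    (ContinuousLinearMap.proj (φ := fun _ : Fin 2 => P''.V) i).comp j''.toContinuousLinearMap
  { toFun := fun T => ⟨T.1.compl₁₂ (p' 0).toLinearMap (p'' 1).toLinearMap -
        T.1.compl₁₂ (p' 1).toLinearMap (p'' 0).toLinearMap, by
      obtain ⟨T, hT, hG⟩ := T
      refine ⟨?_, fun g a b => ?_⟩
      · exact (hT.comp (((p' 0).continuous.comp continuous_fst).prodMk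
          ((p'' 1).continuous.comp continuous_snd))).sub
          (hT.comp (((p' 1).continuous.comp continuous_fst).prodMk
          ((p'' 0).continuous.comp continuous_snd)))
      · have h1 (i : Fin 2) : p' i (R'.ρ g a) = ∑ k, (S.φ g).val i k • P'.ρ g (p' k a) :=
          (congrFun (j'.isIntertwining g a) i).trans (P'.tensorAct_apply S g _ i)
        have h2 (i : Fin 2) : p'' i (R''.ρ g b) = ∑ k, (S.φ g).val i k • P''.ρ g (p'' k b) :=
          (congrFun (j''.isIntertwining g b) i).trans (P''.tensorAct_apply S g _ i)
        -- The group scales the form `x₀ y₁ - x₁ y₀` by this determinant.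
        have hdet : (S.φ g).val 0 0 * (S.φ g).val 1 1 - (S.φ g).val 0 1 * (S.φ g).val 1 0 = 1 := by
          rw [← Matrix.det_fin_two]; exact (S.φ g).2
        simp only [LinearMap.sub_apply, LinearMap.compl₁₂_apply, ContinuousLinearMap.coe_coe,
          h1, h2, Fin.sum_univ_two, map_add, map_smul, LinearMap.add_apply, LinearMap.smul_apply,
          hG, map_sub]
        generalize Q.ρ g (T (p' 0 a) (p'' 1 b)) = u
        generalize Q.ρ g (T (p' 1 a) (p'' 0 b)) = v
        linear_combination (norm := module) congrArg (· • (u - v)) hdet⟩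
    map_add' := fun T U => by
      apply Subtype.ext
      ext a b
      simp
      abel
    map_smul' := fun c T => by
      apply Subtype.ext
      ext a b
      simp [smul_sub] }

lemma contract_apply {R' R'' : FrechetRep.{u} G} (j' : ContIntertwiningMap R'.ρ (P'.tensorC2 S).ρ)
    (j'' : ContIntertwiningMap R''.ρ (P''.tensorC2 S).ρ) (T : homG P' P'' Q)
    {a : R'.V} {b : R''.V} {x : Fin 2 → P'.V} {y : Fin 2 → P''.V}
    (hx : j'.toContinuousLinearMap a = x) (hy : j''.toContinuousLinearMap b = y) :
    (contract j' j'' T).1 a b = T.1 (x 0) (y 1) - T.1 (x 1) (y 0) := by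
  subst hx hy
  rfl

/-- Off the walls `(l' + l'' + 1)² = μ²`, translation does not decrease multiplicities. -/
theorem mult_le_of_translatesTo {R' R'' : FrechetRep.{u} G} (hP' : P'.OrbitDifferentiable)
    (hP'' : P''.OrbitDifferentiable) (hQ : Q.OrbitDifferentiable) {l' l'' μ : ℂ}
    (hl' : P'.HasInfChar S l') (hl'' : P''.HasInfChar S l'') (hμ : Q.HasInfChar S μ)
    (hR' : P'.TranslatesTo S (l' + 1) R') (hR'' : P''.TranslatesTo S (l'' + 1) R'')
    (hne : (l' + l'' + 1) ^ 2 ≠ μ ^ 2) : mult P' P'' Q ≤ mult R' R'' Q := by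
  obtain ⟨j', -, hj'⟩ := hR'
  obtain ⟨j'', -, hj''⟩ := hR''
  refine LinearMap.rank_le_of_injective (contract j' j'')
    ((injective_iff_map_eq_zero (contract j' j'')).2 fun T hT => ?_)
  have hzero (x : Fin 2 → P'.V) (y : Fin 2 → P''.V) (hx : x ∈ (P'.tensorC2 S).primary S (l' + 1))
      (hy : y ∈ (P''.tensorC2 S).primary S (l'' + 1)) :
      T.1 (x 0) (y 1) - T.1 (x 1) (y 0) = 0 := by
    rw [← hj'] at hx
    rw [← hj''] at hy
    obtain ⟨a, ha⟩ := hx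
    obtain ⟨b, hb⟩ := hy
    rw [← contract_apply j' j'' T ha hb, hT]
    rfl
  apply Subtype.ext
  ext a b
  obtain ⟨ha0, ha1⟩ := hP'.mem_primary hl' a
  obtain ⟨hb0, hb1⟩ := hP''.mem_primary hl'' b
  -- Pairing the image of `a ⊗ f₊` with that of `b ⊗ f₋`, and conversely, makes the terms linear in
  -- `H` cancel in `e1 - e2`. What remains is a multiple of `T a b` and the cross terms of the
  -- Casimir element on `T a b`, which `eq`, `ea` and `eb` evaluate.
  have e1 := hzero _ _ ha0 hb1
  have e2 := hzero _ _ ha1 hb0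
  have ea := congrArg (fun v => T.1 v b) (hl' a)
  have eb := congrArg (T.1 a) (hl'' b)
  have eq := hμ (T.1 a b)
  have hact := act_homG (S := S) hP' hP'' hQ T.2
  have hQadd := hQ.act_add (S := S)
  simp only [casimir, hact, hQadd, map_add, map_smul, LinearMap.add_apply, LinearMap.smul_apply]
    at ea eb eq
  simp at e1 e2
  have : ((l' + l'' + 1) ^ 2 - μ ^ 2) • T.1 a b = 0 := by
    linear_combination (norm := module) e1 - e2 + eq - ea - eb
  exact (smul_eq_zero.1 this).resolve_left (sub_ne_zero.2 hne)

end FrechetRep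
end Translation

/-! ### Diagonal unit steps in coherent families -/

section Families

variable {G : Type v} [Group G] [TopologicalSpace G] [ChartedSpace (EuclideanSpace ℝ (Fin 3)) G]
  [LieGroup (𝓡 3) ∞ G] {S : SL2Group G}

namespace FrechetRep

lemma HasInfChar.neg {P : FrechetRep.{u} G} {l : ℂ} (h : P.HasInfChar S l) :
    P.HasInfChar S (-l) := fun w => by rw [neg_sq]; exact h w

lemma TranslatesTo.neg {P R : FrechetRep.{u} G} {l : ℂ} (h : P.TranslatesTo S l R) :
    P.TranslatesTo S (-l) R := by
  simpa [TranslatesTo, primary] using h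

/-- Off the walls, translation in both directions preserves multiplicities. -/
theorem mult_eq_of_translatesTo {P' P'' R' R'' Q : FrechetRep.{u} G} (hP' : P'.OrbitDifferentiable)
    (hP'' : P''.OrbitDifferentiable) (hR' : R'.OrbitDifferentiable) (hR'' : R''.OrbitDifferentiable)
    (hQ : Q.OrbitDifferentiable) {l' l'' μ : ℂ}
    (hl' : P'.HasInfChar S l') (hl'' : P''.HasInfChar S l'')
    (hm' : R'.HasInfChar S (l' + 1)) (hm'' : R''.HasInfChar S (l'' + 1)) (hμ : Q.HasInfChar S μ)
    (hPR' : P'.TranslatesTo S (l' + 1) R') (hPR'' : P''.TranslatesTo S (l'' + 1) R'')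
    (hRP' : R'.TranslatesTo S l' P') (hRP'' : R''.TranslatesTo S l'' P'')
    (hne : (l' + l'' + 1) ^ 2 ≠ μ ^ 2) : mult P' P'' Q = mult R' R'' Q := by
  -- The way back is a step by `+1` from `-(l' + 1)` and `-(l'' + 1)`; its wall is the same, as
  -- `(-l' - l'' - 1)² = (l' + l'' + 1)²`.
  refine le_antisymm (mult_le_of_translatesTo hP' hP'' hQ hl' hl'' hμ hPR' hPR'' hne)
    (mult_le_of_translatesTo hR' hR'' hQ hm'.neg hm''.neg hμ ?_ ?_ ?_)
  · convert hRP'.neg using 1; ring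
  · convert hRP''.neg using 1; ring
  · convert hne using 1; ring

end FrechetRep

/-- Replacing `l` by `ε l` turns a step by `ε` into a step by `+1`, as infinitesimal characters are
defined up to sign. -/
lemma IsReducedCoherentFamily.step {ξ : ℂ} {P : ℂ → FrechetRep.{u} G}
    (hP : IsReducedCoherentFamily S ξ P) (ε : ℤˣ) {l : ℂ} (hl : l ∈ Lam ξ)
    (hl1 : l + ((ε : ℤ) : ℂ) ∈ Lam ξ) :
    (P l).OrbitDifferentiable ∧ (P (l + ((ε : ℤ) : ℂ))).OrbitDifferentiable ∧
    (P l).HasInfChar S (((ε : ℤ) : ℂ) * l) ∧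
    (P (l + ((ε : ℤ) : ℂ))).HasInfChar S (((ε : ℤ) : ℂ) * l + 1) ∧
    (P l).TranslatesTo S (((ε : ℤ) : ℂ) * l + 1) (P (l + ((ε : ℤ) : ℂ))) ∧
    (P (l + ((ε : ℤ) : ℂ))).TranslatesTo S (((ε : ℤ) : ℂ) * l) (P l) := by
  refine ⟨(hP.mem l hl).smooth.orbitDifferentiable, (hP.mem _ hl1).smooth.orbitDifferentiable, ?_⟩
  have h1 := hP.infChar l hl
  have h2 := hP.infChar _ hl1
  obtain ⟨h3, h4⟩ := hP.translate ε l hl hl1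
  rcases Int.units_eq_one_or ε with rfl | rfl
  · simp only [Units.val_one, Int.cast_one, one_mul] at *
    exact ⟨h1, h2, h3, h4⟩
  · simp only [Units.val_neg, Units.val_one, Int.cast_neg, Int.cast_one, neg_mul, one_mul] at *
    refine ⟨h1.neg, ?_, ?_, h4.neg⟩
    · convert h2.neg using 1; ring
    · convert h3.neg using 1; ring

theorem IsReducedCoherentFamily.mult_step {ξ' ξ'' μ : ℂ} {P' P'' : ℂ → FrechetRep.{u} G}
    (hP' : IsReducedCoherentFamily S ξ' P') (hP'' : IsReducedCoherentFamily S ξ'' P'')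
    {Q : FrechetRep.{u} G} (hQ : Q.OrbitDifferentiable) (hμ : Q.HasInfChar S μ) (ε' ε'' : ℤˣ)
    {l' l'' : ℂ} (hl' : l' ∈ Lam ξ') (hm' : l' + ((ε' : ℤ) : ℂ) ∈ Lam ξ')
    (hl'' : l'' ∈ Lam ξ'') (hm'' : l'' + ((ε'' : ℤ) : ℂ) ∈ Lam ξ'')
    (hne : (((ε' : ℤ) : ℂ) * l' + ((ε'' : ℤ) : ℂ) * l'' + 1) ^ 2 ≠ μ ^ 2) :
    mult (P' l') (P'' l'') Q =
      mult (P' (l' + ((ε' : ℤ) : ℂ))) (P'' (l'' + ((ε'' : ℤ) : ℂ))) Q := by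
  obtain ⟨a1, a2, a3, a4, a5, a6⟩ := hP'.step ε' hl' hm'
  obtain ⟨b1, b2, b3, b4, b5, b6⟩ := hP''.step ε'' hl'' hm''
  exact FrechetRep.mult_eq_of_translatesTo a1 b1 a2 b2 hQ a3 b3 a4 b4 hμ a5 b5 a6 b6 hne

end Families

/-! ### Geometry of the regions cut out by the fences -/

section Fences

/-- `Λ(ξ)` is a half-line or a line of integer translates of `ξ`. -/
lemma exists_direction_Lam (ξ : ℂ) : ∃ s : ℤˣ, ∀ k m : ℤ, (s : ℤ) * k ≤ s * m →
    ξ + k ∈ Lam ξ → ξ + m ∈ Lam ξ := by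
  by_cases h : ∀ n : ℤ, ξ ≠ n
  · exact ⟨1, fun k m _ _ => Or.inl ⟨h, m, add_comm _ _⟩⟩
  push Not at h
  obtain ⟨n, rfl⟩ := h
  have hLam (k : ℤ) : (n : ℂ) + k ∈ Lam n ↔ (0 < n ∧ 0 < n + k) ∨ (n < 0 ∧ n + k < 0) := by
    have e : (n : ℂ) + k = ((n + k : ℤ) : ℂ) := by push_cast; rfl
    rw [e]
    constructor
    · rintro (⟨h, -⟩ | ⟨⟨a, ha, ha'⟩, b, hb, hb'⟩ | ⟨⟨a, ha, ha'⟩, b, hb, hb'⟩)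
      · exact absurd rfl (h n)
      · rw [Int.cast_inj] at ha' hb'
        left; omega
      · rw [Int.cast_inj] at ha' hb'
        right; omega
    · rintro (⟨h1, h2⟩ | ⟨h1, h2⟩)
      · exact Or.inr (Or.inl ⟨⟨n, h1, rfl⟩, _, h2, rfl⟩)
      · exact Or.inr (Or.inr ⟨⟨n, h1, rfl⟩, _, h2, rfl⟩)
  -- `Λ(0)` is empty, so the value `n = 0` fits either direction.
  rcases le_or_gt n 0 with hn | hn
  · refine ⟨-1, fun k m hkm hk => ?_⟩
    rw [hLam] at hk ⊢
    simp at hkm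
    omega
  · refine ⟨1, fun k m hkm hk => ?_⟩
    rw [hLam] at hk ⊢
    simp at hkm
    omega

lemma sign_eq_sign_iff_of_odd {m n : ℤ} (hm : Odd m) (hn : Odd n) :
    SignType.sign (m : ℂ).re = SignType.sign (n : ℂ).re ↔ (0 < m ↔ 0 < n) := by
  rw [Complex.intCast_re, Complex.intCast_re]
  have key (k : ℤ) (hk : Odd k) : SignType.sign (k : ℝ) = if 0 < k then 1 else -1 := by
    split_ifs with h
    · exact sign_pos (by exact_mod_cast h)
    · have : k < 0 := by obtain ⟨j, rfl⟩ := hk; omega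
      exact sign_neg (by exact_mod_cast this)
  rw [key m hm, key n hn]
  split_ifs with h1 h2 h2 <;> simp [h1, h2]

/-- Under the parity condition the linear forms take odd, hence nonzero, values on the lattice, so
the sign conditions become integer inequalities. -/
lemma mem_D_iff {ξ' ξ'' μ : ℂ} {k m : ℤ} :
    (ξ' + k, ξ'' + m) ∈ D ξ' ξ'' μ ↔ ξ' + k ∈ Lam ξ' ∧ ξ'' + m ∈ Lam ξ'' ∧ k ≡ m [ZMOD 2] ∧
      ∀ (α β : ℤˣ) (M : ℤ), Odd M → lin α β μ (ξ', ξ'') = M →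
        (0 < M + α * k + β * m ↔ 0 < M) := by
  have hXi : (ξ' + k, ξ'' + m) ∈ Xi ξ' ξ'' ↔
      ξ' + k ∈ Lam ξ' ∧ ξ'' + m ∈ Lam ξ'' ∧ k ≡ m [ZMOD 2] := by
    constructor
    · rintro ⟨h1, h2, a, b, hab, he⟩
      simp only [Prod.mk.injEq, add_right_inj, Int.cast_inj] at he
      obtain ⟨rfl, rfl⟩ := he
      exact ⟨h1, h2, hab⟩
    · rintro ⟨h1, h2, h3⟩
      exact ⟨h1, h2, k, m, h3, rfl⟩
  have hsign (hkm : k ≡ m [ZMOD 2]) (α β : ℤˣ) (M : ℤ) (hM : Odd M)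
      (hlin : lin α β μ (ξ', ξ'') = M) :
      SignType.sign (lin α β μ (ξ' + k, ξ'' + m)).re = SignType.sign (lin α β μ (ξ', ξ'')).re ↔
        (0 < M + α * k + β * m ↔ 0 < M) := by
    have h1 : lin α β μ (ξ' + k, ξ'' + m) = ((M + α * k + β * m : ℤ) : ℂ) := by
      push_cast
      rw [← hlin, lin, lin]
      ring
    have h2 : Odd (M + α * k + β * m) := by
      rw [Int.odd_iff] at hM ⊢
      rw [Int.ModEq] at hkm
      rcases Int.units_eq_one_or α with rfl | rfl <;>
      rcases Int.units_eq_one_or β with rfl | rfl <;> simp <;> omega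
    rw [h1, hlin, sign_eq_sign_iff_of_odd h2 hM]
  simp only [D, Set.mem_iInter, Dab, Set.mem_ofPred_eq, ParityCond]
  constructor
  · intro h
    obtain ⟨h1, h2, h3⟩ := hXi.1 (h 1 1).1
    refine ⟨h1, h2, h3, fun α β M hM hlin => (hsign h3 α β M hM hlin).1 ((h α β).2 ?_)⟩
    obtain ⟨n, rfl⟩ := hM
    exact ⟨n, by rw [hlin]; push_cast; rfl⟩
  · rintro ⟨h1, h2, h3, h4⟩ α β
    refine ⟨hXi.2 ⟨h1, h2, h3⟩, ?_⟩
    rintro ⟨n, hn⟩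
    have hn' : lin α β μ (ξ', ξ'') = ((2 * n + 1 : ℤ) : ℂ) := by rw [hn]; push_cast; rfl
    exact (hsign h3 α β _ ⟨n, rfl⟩ hn').2 (h4 α β _ ⟨n, rfl⟩ hn')

lemma exists_of_mem_D {ξ' ξ'' μ : ℂ} {p : ℂ × ℂ} (hp : p ∈ D ξ' ξ'' μ) :
    ∃ k m : ℤ, p = (ξ' + k, ξ'' + m) := by
  simp only [D, Set.mem_iInter] at hp
  obtain ⟨-, -, k, m, -, h⟩ := (hp 1 1).1
  exact ⟨k, m, h⟩

/-- On a wall the left base is `σ μ` for a sign `σ`. Then the form with coefficients `-σ ε'`, `-σ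
ε''` satisfies the parity condition and equals `σ` at the start of the step and `-σ` at its end, so
both ends cannot lie in `D`. -/
lemma off_wall_of_mem_D {ξ' ξ'' μ : ℂ} {k m : ℤ} {ε' ε'' : ℤˣ}
    (h : (ξ' + k, ξ'' + m) ∈ D ξ' ξ'' μ)
    (h1 : (ξ' + ((k + ε' : ℤ) : ℂ), ξ'' + ((m + ε'' : ℤ) : ℂ)) ∈ D ξ' ξ'' μ) :
    (((ε' : ℤ) : ℂ) * (ξ' + k) + ((ε'' : ℤ) : ℂ) * (ξ'' + m) + 1) ^ 2 ≠ μ ^ 2 := by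
  intro heq
  obtain ⟨-, -, hkm, h⟩ := mem_D_iff.1 h
  obtain ⟨-, -, -, h1⟩ := mem_D_iff.1 h1
  rw [Int.ModEq] at hkm
  obtain ⟨σ, hσ⟩ : ∃ σ : ℤˣ, ((ε' : ℤ) : ℂ) * (ξ' + k) + ((ε'' : ℤ) : ℂ) * (ξ'' + m) + 1 =
      ((σ : ℤ) : ℂ) * μ := by
    rcases sq_eq_sq_iff_eq_or_eq_neg.1 heq with h | h
    · exact ⟨1, by simp [h]⟩
    · exact ⟨-1, by simp [h]⟩
  have hlin : lin (-σ * ε') (-σ * ε'') μ (ξ', ξ'') = ((σ * (1 + ε' * k + ε'' * m) : ℤ) : ℂ) := by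
    have hσ2 : ((σ : ℤ) : ℂ) * ((σ : ℤ) : ℂ) = 1 := by
      rcases Int.units_eq_one_or σ with rfl | rfl <;> simp
    simp only [lin]
    push_cast
    linear_combination (-((σ : ℤ) : ℂ)) * hσ - μ * hσ2
  have hodd : Odd ((σ : ℤ) * (1 + ε' * k + ε'' * m)) := by
    rw [Int.odd_iff]
    rcases Int.units_eq_one_or σ with rfl | rfl <;>
    rcases Int.units_eq_one_or ε' with rfl | rfl <;>
    rcases Int.units_eq_one_or ε'' with rfl | rfl <;> simp <;> omega
  have e1 := h _ _ _ hodd hlin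
  have e2 := h1 _ _ _ hodd hlin
  rcases Int.units_eq_one_or σ with rfl | rfl <;>
  rcases Int.units_eq_one_or ε' with rfl | rfl <;>
  rcases Int.units_eq_one_or ε'' with rfl | rfl <;> simp at e1 e2 <;> omega

/-- Convexity along diagonals: half-planes, lines and half-lines are convex, and diagonal steps keep
the parity of `k - m`. -/
lemma mem_D_of_between {ξ' ξ'' μ : ℂ} {k m : ℤ} {ε' ε'' : ℤˣ} {t n : ℤ} (ht : 0 ≤ t) (htn : t ≤ n)
    (h : (ξ' + k, ξ'' + m) ∈ D ξ' ξ'' μ)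
    (h1 : (ξ' + ((k + ε' * n : ℤ) : ℂ), ξ'' + ((m + ε'' * n : ℤ) : ℂ)) ∈ D ξ' ξ'' μ) :
    (ξ' + ((k + ε' * t : ℤ) : ℂ), ξ'' + ((m + ε'' * t : ℤ) : ℂ)) ∈ D ξ' ξ'' μ := by
  have hLam (ξ : ℂ) (k : ℤ) (ε : ℤˣ) (h : ξ + k ∈ Lam ξ)
      (h1 : ξ + ((k + ε * n : ℤ) : ℂ) ∈ Lam ξ) : ξ + ((k + ε * t : ℤ) : ℂ) ∈ Lam ξ := by
    obtain ⟨s, hs⟩ := exists_direction_Lam ξ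
    have : (s : ℤ) * k ≤ s * (k + ε * t) ∨ (s : ℤ) * (k + ε * n) ≤ s * (k + ε * t) := by
      rcases Int.units_eq_one_or s with rfl | rfl <;>
      rcases Int.units_eq_one_or ε with rfl | rfl <;> simp <;> omega
    rcases this with h' | h'
    · exact hs _ _ h' h
    · exact hs _ _ h' h1
  obtain ⟨a1, a2, a3, a4⟩ := mem_D_iff.1 h
  obtain ⟨b1, b2, b3, b4⟩ := mem_D_iff.1 h1
  refine mem_D_iff.2 ⟨hLam _ _ _ a1 b1, hLam _ _ _ a2 b2, ?_, fun α β M hM hlin => ?_⟩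
  · rw [Int.ModEq] at a3 ⊢
    rcases Int.units_eq_one_or ε' with rfl | rfl <;>
    rcases Int.units_eq_one_or ε'' with rfl | rfl <;> simp <;> omega
  · have c1 := a4 α β M hM hlin
    have c2 := b4 α β M hM hlin
    rcases Int.units_eq_one_or α with rfl | rfl <;>
    rcases Int.units_eq_one_or β with rfl | rfl <;>
    rcases Int.units_eq_one_or ε' with rfl | rfl <;>
    rcases Int.units_eq_one_or ε'' with rfl | rfl <;> simp at c1 c2 ⊢ <;> omega

/-- A function on `D` which is invariant under diagonal unit steps is constant. -/
theorem eq_of_mem_D {ξ' ξ'' μ : ℂ} {T : Type*} (f : ℂ × ℂ → T)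
    (hf : ∀ (k m : ℤ) (ε' ε'' : ℤˣ), (ξ' + (k : ℂ), ξ'' + (m : ℂ)) ∈ D ξ' ξ'' μ →
      (ξ' + ((k + ε' : ℤ) : ℂ), ξ'' + ((m + ε'' : ℤ) : ℂ)) ∈ D ξ' ξ'' μ →
      f (ξ' + k, ξ'' + m) = f (ξ' + ((k + ε' : ℤ) : ℂ), ξ'' + ((m + ε'' : ℤ) : ℂ)))
    {p q : ℂ × ℂ} (hp : p ∈ D ξ' ξ'' μ) (hq : q ∈ D ξ' ξ'' μ) : f p = f q := by
  have seg (ε' ε'' : ℤˣ) (n : ℕ) : ∀ k m : ℤ, (ξ' + (k : ℂ), ξ'' + (m : ℂ)) ∈ D ξ' ξ'' μ →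
      (ξ' + ((k + ε' * n : ℤ) : ℂ), ξ'' + ((m + ε'' * n : ℤ) : ℂ)) ∈ D ξ' ξ'' μ →
      f (ξ' + k, ξ'' + m) = f (ξ' + ((k + ε' * n : ℤ) : ℂ), ξ'' + ((m + ε'' * n : ℤ) : ℂ)) := by
    induction n with
    | zero => intro k m _ _; simp
    | succ n ih =>
      intro k m h h1
      have h2 := mem_D_of_between (t := 1) (by norm_num) (by push_cast; omega) h h1
      simp only [mul_one] at h2
      have e (ε : ℤˣ) (j : ℤ) : j + ε * ((n + 1 : ℕ) : ℤ) = (j + ε) + ε * (n : ℤ) := by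
        push_cast; ring
      rw [e, e] at h1 ⊢
      exact (hf k m ε' ε'' h h2).trans (ih _ _ h2 h1)
  have seg' (k m k₁ m₁ : ℤ) (h : (ξ' + (k : ℂ), ξ'' + (m : ℂ)) ∈ D ξ' ξ'' μ)
      (h1 : (ξ' + (k₁ : ℂ), ξ'' + (m₁ : ℂ)) ∈ D ξ' ξ'' μ)
      (hd : k₁ - k = m₁ - m ∨ k₁ - k = m - m₁) :
      f (ξ' + k, ξ'' + m) = f (ξ' + k₁, ξ'' + m₁) := by
    obtain ⟨n, ε', ε'', e1, e2⟩ : ∃ (n : ℕ) (ε' ε'' : ℤˣ), k₁ = k + ε' * n ∧ m₁ = m + ε'' * n := by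
      rcases le_total k k₁ with hk | hk <;> rcases le_total m m₁ with hm | hm
      · exact ⟨(k₁ - k).natAbs, 1, 1, by simp only [Units.val_one, one_mul]; omega, by simp only [Units.val_one, one_mul]; omega⟩
      · exact ⟨(k₁ - k).natAbs, 1, -1, by simp only [Units.val_one, one_mul]; omega, by simp only [Units.val_neg, Units.val_one, neg_mul, one_mul]; omega⟩
      · exact ⟨(k₁ - k).natAbs, -1, 1, by simp only [Units.val_neg, Units.val_one, neg_mul, one_mul]; omega, by simp only [Units.val_one, one_mul]; omega⟩
      · exact ⟨(k₁ - k).natAbs, -1, -1, by simp only [Units.val_neg, Units.val_one, neg_mul, one_mul]; omega, by simp only [Units.val_neg, Units.val_one, neg_mul, one_mul]; omega⟩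
    subst e1 e2
    exact seg ε' ε'' n k m h h1
  obtain ⟨k, m, rfl⟩ := exists_of_mem_D hp
  obtain ⟨k₁, m₁, rfl⟩ := exists_of_mem_D hq
  obtain ⟨s', hs'⟩ := exists_direction_Lam ξ'
  obtain ⟨s'', hs''⟩ := exists_direction_Lam ξ''
  wlog hle : (s' : ℤ) * k + s'' * m ≤ s' * k₁ + s'' * m₁ generalizing k m k₁ m₁
  · exact (this k₁ m₁ hq k m hp (le_of_not_ge hle)).symm
  obtain ⟨a1, a2, a3, a4⟩ := mem_D_iff.1 hp
  obtain ⟨b1, b2, b3, b4⟩ := mem_D_iff.1 hq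
  rw [Int.ModEq] at a3 b3
  -- The height `s' k + s'' m` grows by 2 with each step in direction `(s', s'')`, and parity makes
  -- the height difference even.
  obtain ⟨n, hn⟩ : ∃ n : ℤ, (s' : ℤ) * k₁ + s'' * m₁ = s' * k + s'' * m + 2 * n := by
    refine ⟨((s' : ℤ) * k₁ + s'' * m₁ - (s' * k + s'' * m)) / 2, ?_⟩
    rcases Int.units_eq_one_or s' with rfl | rfl <;>
    rcases Int.units_eq_one_or s'' with rfl | rfl <;> simp <;> omega
  have hn0 : 0 ≤ n := by omega
  -- The path climbs from the lower point to the height of the other, in the direction in which both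
  -- parameter sets are unbounded. At the corner, forms proportional to the height take their value
  -- at the second point, the others their value at the first.
  have hcorner : (ξ' + ((k + s' * n : ℤ) : ℂ), ξ'' + ((m + s'' * n : ℤ) : ℂ)) ∈ D ξ' ξ'' μ := by
    refine mem_D_iff.2 ⟨hs' k _ ?_ a1, hs'' m _ ?_ a2, ?_, fun α β M hM hlin => ?_⟩
    · rcases Int.units_eq_one_or s' with rfl | rfl <;> simp <;> omega
    · rcases Int.units_eq_one_or s'' with rfl | rfl <;> simp <;> omega
    · rw [Int.ModEq]
      rcases Int.units_eq_one_or s' with rfl | rfl <;>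
      rcases Int.units_eq_one_or s'' with rfl | rfl <;> simp <;> omega
    · have c1 := a4 α β M hM hlin
      have c2 := b4 α β M hM hlin
      rcases Int.units_eq_one_or α with rfl | rfl <;>
      rcases Int.units_eq_one_or β with rfl | rfl <;>
      rcases Int.units_eq_one_or s' with rfl | rfl <;>
      rcases Int.units_eq_one_or s'' with rfl | rfl <;> simp at c1 c2 hn ⊢ <;> omega
  refine (seg' _ _ _ _ hp hcorner ?_).trans (seg' _ _ _ _ hcorner hq ?_)
  · rcases Int.units_eq_one_or s' with rfl | rfl <;>
    rcases Int.units_eq_one_or s'' with rfl | rfl <;> simp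
  · rcases Int.units_eq_one_or s' with rfl | rfl <;>
    rcases Int.units_eq_one_or s'' with rfl | rfl <;> simp at hn ⊢ <;> omega

end Fences

end SL2Fusion

end

theorem mainTheorem4 {G : Type*} [Group G] [TopologicalSpace G]
    [ChartedSpace (EuclideanSpace ℝ (Fin 3)) G] [LieGroup (𝓡 3) ∞ G]
    (S : SL2Fusion.SL2Group G)
    (ξ' ξ'' μ : ℂ) (hξ' : ξ' ≠ 0) (hξ'' : ξ'' ≠ 0)
    (P' P'' : ℂ → SL2Fusion.FrechetRep G)
    (hP' : SL2Fusion.IsReducedCoherentFamily S ξ' P')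
    (hP'' : SL2Fusion.IsReducedCoherentFamily S ξ'' P'')
    (Q : SL2Fusion.FrechetRep G) (hQ : Q.IsInM S) (hQμ : Q.HasInfChar S μ) :
    (∀ p ∈ SL2Fusion.D ξ' ξ'' μ, ∀ q ∈ SL2Fusion.D ξ' ξ'' μ,
      SL2Fusion.mult (P' p.1) (P'' p.2) Q = SL2Fusion.mult (P' q.1) (P'' q.2) Q) ∧
    (∀ p ∈ SL2Fusion.D ξ' ξ'' μ, ∀ q ∈ SL2Fusion.Xi ξ' ξ'',
      SL2Fusion.mult (P' p.1) (P'' p.2) Q ≠ SL2Fusion.mult (P' q.1) (P'' q.2) Q →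
      ∃ α β : ℤˣ, SL2Fusion.ParityCond ξ' ξ'' μ α β ∧
        SignType.sign (SL2Fusion.lin α β μ p).re ≠
          SignType.sign (SL2Fusion.lin α β μ q).re) := by
  have hconst : ∀ p ∈ SL2Fusion.D ξ' ξ'' μ, ∀ q ∈ SL2Fusion.D ξ' ξ'' μ,
      SL2Fusion.mult (P' p.1) (P'' p.2) Q = SL2Fusion.mult (P' q.1) (P'' q.2) Q := by
    intro p hp q hq
    refine SL2Fusion.eq_of_mem_D (fun p => SL2Fusion.mult (P' p.1) (P'' p.2) Q)
      (fun k m ε' ε'' h h1 => ?_) hp hq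
    have hwall := SL2Fusion.off_wall_of_mem_D h h1
    obtain ⟨a1, a2, -⟩ := SL2Fusion.mem_D_iff.1 h
    obtain ⟨b1, b2, -⟩ := SL2Fusion.mem_D_iff.1 h1
    have e (ξ : ℂ) (j i : ℤ) : ξ + ((j + i : ℤ) : ℂ) = ξ + j + i := by push_cast; ring
    simp only [e] at b1 b2 ⊢
    exact hP'.mult_step hP'' hQ.smooth.orbitDifferentiable hQμ ε' ε'' a1 b1 a2 b2 hwall
  refine ⟨hconst, fun p hp q hq hne => ?_⟩
  -- If no relevant sign separates `p` from `q`, then `q` meets all the sign conditions that define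
  -- `D`.
  by_contra! hcon
  refine hne (hconst p hp q ?_)
  simp only [SL2Fusion.D, Set.mem_iInter] at hp ⊢
  exact fun α β => ⟨hq, fun hpar => (hcon α β hpar).symm.trans ((hp α β).2 hpar)⟩
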